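/- Let $0\le\alpha<1$. For $n\ge 2$ let $H=\sum_{1\le i<j\le n}J_{ij}\,(|i\rangle\langle j|+|j\rangle\langle i|)$ on $\mathbb C^n$, where $J_{ij}=\frac1{|j-i|^{\alpha}}+\frac1{|n-(j-i)|^{\alpha}}$, be the Hamiltonian of the long-range ring of $n$ sites. Let $\lambda_1\le\dots\le\lambda_n$ be its eigenvalues with multiplicity, put $\tilde\lambda_k=\frac{\lambda_k-\lambda_1}{\lambda_n-\lambda_1}$, and let $$\Delta_n=1-\tilde\lambda_{n-1},\qquad S_q=\frac1n\sum_{i=1}^{n-1}\frac1{(1-\tilde\lambda_i)^q},\qquad F_\infty(n)=\frac{S_1^2}{S_2}$$ be the rescaled spectral gap, the spectral parameters and the asymptotic fidelity. For $\gamma\in\mathbb R$, a marked site $w\in\{1,\dots,n\}$ and a time $T$, let $$F_{n,\gamma,w}(T)=\bigl|\langle w|\,e^{-i(\gamma H+|w\rangle\langle w|)T}\,|s\rangle\bigr|^2,\qquad |s\rangle=\frac1{\sqrt n}\sum_{j=1}^n|j\rangle,$$ be the probability that the Childs–Goldstone search finds $w$ at time $T$. Then the following hold; all constants depend only on $\alpha$.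 1. There is a constant $c>0$ such that $c\le\Delta_n\le 1$ for all $n\ge2$. 2. For all $n\ge 2$, $\Delta_n\left(1-\frac1n\right)\le F_\infty(n)\le 1$. 3. There is a constant $c>0$ with $F_\infty(n)\ge c$ for all $n\ge2$, and $F_\infty(n)$ tends to a positive constant as $n\to\infty$. 4. There are constants $C,c>0$ and, for each $n\ge2$, a hopping rate $\gamma_n>0$ and a time $T_n$ with $0<T_n\le C\sqrt n$, neither depending on the marked site, such that $F_{n,\gamma_n,w}(T_n)\ge c$ for all $n\ge 2$ and every marked site $w$. Moreover these can be chosen such that, as $n\to\infty$, $T_n\sim\frac{\pi}{2}\sqrt{n/F_\infty(n)}$ and $F_{n,\gamma_n,w}(T_n)-F_\infty(n)\to0$ uniformly in $w$. -/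

import Mathlib

open Filter Topology Asymptotics
open scoped Matrix

noncomputable section

namespace LongRangeSearch

/-- The coupling `1 / r ^ α + 1 / |n - r| ^ α` between two sites of the closed chain of `n` spins
whose labels differ by `r`. -/
def coupling (α : ℝ) (n : ℕ) (r : ℝ) : ℝ :=
  1 / r ^ α + 1 / |(n : ℝ) - r| ^ α

/-- The Hamiltonian `H = ∑_{i < j} J_{ij} (|i⟩⟨j| + |j⟩⟨i|)` of the long-range ring in the
single-excitation basis, as an `n × n` matrix. -/
def ringHamiltonian (α : ℝ) (n : ℕ) : Matrix (Fin n) (Fin n) ℂ :=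
  Matrix.of fun i j =>
    if i = j then 0 else ((coupling α n |((j : ℕ) : ℝ) - ((i : ℕ) : ℝ)| : ℝ) : ℂ)

theorem ringHamiltonian_isHermitian (α : ℝ) (n : ℕ) : (ringHamiltonian α n).IsHermitian := by
  ext i j
  simp only [ringHamiltonian, Matrix.conjTranspose_apply, Matrix.of_apply, eq_comm (a := j),
    abs_sub_comm ((i : ℕ) : ℝ)]
  split_ifs <;> simp

/-- The eigenvalues `λ_1 ≤ λ_2 ≤ … ≤ λ_n` of the ring Hamiltonian, with multiplicity, in increasing
order. The index `k` is meant to run over `1, …, n`; other indices give junk values. Mathlib's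
`eigenvalues₀` lists the eigenvalues in decreasing order, starting at index `0`. -/
def ringEigenvalue (α : ℝ) (n k : ℕ) : ℝ :=
  if h : n - k < n then
    (ringHamiltonian_isHermitian α n).eigenvalues₀ ⟨n - k, by rwa [Fintype.card_fin]⟩
  else 0

/-- The rescaled eigenvalues: the largest is `1` and the smallest is `0`. -/
def rescaledEigenvalue (α : ℝ) (n k : ℕ) : ℝ :=
  (ringEigenvalue α n k - ringEigenvalue α n 1) / (ringEigenvalue α n n - ringEigenvalue α n 1)

/-- The rescaled spectral gap `Δ = 1 - λ̃_{n-1}`. -/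
def spectralGap (α : ℝ) (n : ℕ) : ℝ :=
  1 - rescaledEigenvalue α n (n - 1)

/-- The parameters `S_q = (1/n) ∑_{i=1}^{n-1} 1 / (1 - λ̃_i)^q`. -/
def spectralSum (α : ℝ) (n q : ℕ) : ℝ :=
  1 / (n : ℝ) * ∑ i ∈ Finset.Icc 1 (n - 1), 1 / (1 - rescaledEigenvalue α n i) ^ q

/-- The asymptotic fidelity `F_∞ = ν² = S_1² / S_2`. -/
def asymptoticFidelity (α : ℝ) (n : ℕ) : ℝ :=
  spectralSum α n 1 ^ 2 / spectralSum α n 2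

/-- The search Hamiltonian `γ H + |w⟩⟨w|`. -/
def searchHamiltonian (α γ : ℝ) (n : ℕ) (w : Fin n) : Matrix (Fin n) (Fin n) ℂ :=
  (γ : ℂ) • ringHamiltonian α n + Matrix.single w w 1

/-- The initial state `|s⟩ = (1/√n) ∑_j |j⟩`. -/
def uniformState (n : ℕ) : Fin n → ℂ :=
  fun _ => ((1 / Real.sqrt n : ℝ) : ℂ)

/-- The probability `|⟨w| exp(-i H_search T) |s⟩|²` that the measurement at time `T` finds the marked
site `w`. -/
def searchFidelity (α γ : ℝ) (n : ℕ) (w : Fin n) (T : ℝ) : ℝ :=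
  ‖(NormedSpace.exp ((-Complex.I * (T : ℂ)) • searchHamiltonian α γ n w) *ᵥ uniformState n) w‖ ^ 2

end LongRangeSearch

end

/-! ### Fourier diagonalization of the ring -/

namespace LongRangeSearch

open Finset ZMod

/-! The ring Hamiltonian is circulant, so plane waves diagonalize it, with top eigenvalue $E_0$ on
the uniform state $s$. Every coupling is at least $2n^{-\alpha}$ and $\sum_d(1-\cos(2\pi dk/n))=n$
for $k\ne0$, so $E_0-E_k\ge 2n^{1-\alpha}$ (`dispersion_gap`), while $E_0\le
2n^{1-\alpha}/(1-\alpha)$ (`dispersion_zero_le`). As the spectrum lies in $[-E_0,E_0]$, the rescaled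
gap is bounded below.

The fidelity in fact tends to $1$. From $\operatorname{tr}H^2=n\sum_d J_d^2\le 2nE_0$ most $E_k$ are
negligible against $E_0$, so the numbers $1/(E_0-E_k)$ are nearly constant in mean square, and
$1-F_\infty$ is their normalized variance (`one_sub_asymptoticFidelity_le_rpow`).

For the search, let $\gamma=\frac1n\sum_{k\ne0}(E_0-E_k)^{-1}$ and let $\varphi$ be the reduced
resolvent applied to $w$, divided by $\gamma$, so that $\varphi(w)=1$. With $c=\gamma E_0$ and
$\kappa=1/\sqrt n$ the search Hamiltonian $B$ satisfies $B\varphi=c\varphi+\kappa s$ and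
$Bs=cs+\kappa w$ exactly. Since $\|w-\varphi\|^2=1/F_\infty-1\to0$, this is almost a two-level
rotation, and Duhamel's formula shows that at time $\pi/(2\kappa)$ the state is within
$\frac\pi2\|w-\varphi\|$ of $\varphi$ up to a phase (`norm_rotation_sub_exp_apply_le`). The finitely
many small $n$ are handled by continuity at time $0$. -/

theorem coupling_sub {n : ℕ} (α : ℝ) {r : ℝ} (h0 : 0 ≤ r) (hn : r ≤ n) :
    coupling α n (n - r) = coupling α n r := by
  unfold coupling
  rw [sub_sub_cancel, abs_of_nonneg h0, abs_of_nonneg (sub_nonneg.2 hn), add_comm]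

theorem sum_fin_natCast_zmod {n : ℕ} [NeZero n] {M : Type*} [AddCommMonoid M] (f : ZMod n → M) :
    ∑ j : Fin n, f ((j : ℕ) : ZMod n) = ∑ x : ZMod n, f x := by
  refine Fintype.sum_bijective (fun j : Fin n => ((j : ℕ) : ZMod n)) ⟨fun i j h => ?_, fun x => ?_⟩
    _ _ fun _ => rfl
  · have := congrArg ZMod.val h
    simp only [ZMod.val_cast_of_lt (Fin.is_lt _)] at this
    exact Fin.ext this
  · exact ⟨⟨x.val, x.val_lt⟩, by simp⟩

/-- The coupling as a function on the cyclic group, without self-interaction. -/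
noncomputable def ringCoupling (α : ℝ) (n : ℕ) (d : ZMod n) : ℝ :=
  if d = 0 then 0 else coupling α n d.val

theorem natCast_fin_inj {n : ℕ} {i j : Fin n} :
    ((i : ℕ) : ZMod n) = ((j : ℕ) : ZMod n) ↔ i = j := by
  have : NeZero n := ⟨i.pos.ne'⟩
  refine ⟨fun h => ?_, fun h => h ▸ rfl⟩
  have := congrArg ZMod.val h
  simp only [ZMod.val_cast_of_lt (Fin.is_lt _)] at this
  exact Fin.ext this

theorem ringCoupling_neg (α : ℝ) (n : ℕ) [NeZero n] (d : ZMod n) :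
    ringCoupling α n (-d) = ringCoupling α n d := by
  unfold ringCoupling
  by_cases h : d = 0
  · simp [h]
  · have : NeZero d := ⟨h⟩
    rw [if_neg h, if_neg (neg_ne_zero.2 h), ZMod.val_neg_of_ne_zero, Nat.cast_sub d.val_lt.le,
      coupling_sub α (by positivity) (by exact_mod_cast d.val_lt.le)]

/-- Circulance: replacing $r$ by $n-r$ swaps the two terms of the coupling, so only the class of
$i-j$ modulo $n$ matters, and not its sign. -/
theorem ringHamiltonian_apply (α : ℝ) (n : ℕ) (i j : Fin n) :
    ringHamiltonian α n i j =
      ((ringCoupling α n (((i : ℕ) : ZMod n) - ((j : ℕ) : ZMod n)) : ℝ) : ℂ) := by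
  have : NeZero n := ⟨i.pos.ne'⟩
  wlog hij : j ≤ i generalizing i j
  · rw [← (ringHamiltonian_isHermitian α n).apply, this j i (le_of_not_ge hij), ← neg_sub,
      ringCoupling_neg]
    simp
  · simp only [ringHamiltonian, ringCoupling, Matrix.of_apply, sub_eq_zero, natCast_fin_inj]
    split_ifs with h
    · simp
    · rw [← Nat.cast_sub hij, ZMod.val_cast_of_lt (by omega), abs_sub_comm,
        ← Nat.cast_sub hij, abs_of_nonneg (Nat.cast_nonneg _)]

/-- The dispersion relation of the ring: the eigenvalue of the plane wave with wave number `k`. -/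
noncomputable def dispersion (α : ℝ) (n : ℕ) [NeZero n] (k : Fin n) : ℝ :=
  ∑ d : ZMod n, ringCoupling α n d * (stdAddChar (d * ((k : ℕ) : ZMod n))).re

/-- The unitary matrix of the discrete Fourier transform. -/
noncomputable def fourierMatrix (n : ℕ) [NeZero n] : Matrix (Fin n) (Fin n) ℂ :=
  Matrix.of fun j k =>
    stdAddChar (((j : ℕ) : ZMod n) * ((k : ℕ) : ZMod n)) * ((1 / Real.sqrt n : ℝ) : ℂ)

theorem fourierMatrix_apply_zero (n : ℕ) [NeZero n] (j : Fin n) :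
    fourierMatrix n j 0 = ((1 / Real.sqrt n : ℝ) : ℂ) := by
  simp [fourierMatrix]

theorem fourierMatrix_mul_conj (n : ℕ) [NeZero n] (j k : Fin n) :
    fourierMatrix n j k * star (fourierMatrix n j k) = 1 / (n : ℂ) := by
  have hn : (0 : ℝ) ≤ n := by positivity
  rw [Complex.star_def, Complex.mul_conj']
  simp only [fourierMatrix, Matrix.of_apply, norm_mul, AddChar.norm_apply, one_mul,
    Complex.norm_real, Real.norm_eq_abs, ← Complex.ofReal_pow, sq_abs, div_pow, Real.sq_sqrt hn]
  simp

theorem sum_stdAddChar_mul (n : ℕ) [NeZero n] (b : ZMod n) :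
    ∑ x : ZMod n, stdAddChar (x * b) = if b = 0 then (n : ℂ) else 0 := by
  rw [AddChar.sum_mulShift b (isPrimitive_stdAddChar n), ZMod.card]
  split_ifs <;> simp

theorem conjTranspose_fourierMatrix_mul (n : ℕ) [NeZero n] :
    (fourierMatrix n)ᴴ * fourierMatrix n = 1 := by
  have hn : (0 : ℝ) ≤ n := by positivity
  have hn' : (n : ℂ) ≠ 0 := by exact_mod_cast NeZero.ne n
  have hs : ((1 / Real.sqrt n : ℝ) : ℂ) * ((1 / Real.sqrt n : ℝ) : ℂ) = 1 / (n : ℂ) := by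
    rw [← Complex.ofReal_mul, ← sq, div_pow, Real.sq_sqrt hn]; simp
  ext k l
  have : ∀ j : Fin n, star (fourierMatrix n j k) * fourierMatrix n j l =
      stdAddChar (((j : ℕ) : ZMod n) * (((l : ℕ) : ZMod n) - ((k : ℕ) : ZMod n))) *
        (1 / (n : ℂ)) := by
    intro j
    rw [← hs, mul_sub, sub_eq_add_neg, AddChar.map_add_eq_mul, AddChar.map_neg_eq_conj]
    simp only [fourierMatrix, Matrix.of_apply, star_mul', Complex.star_def, Complex.conj_ofReal]
    ring
  simp only [Matrix.mul_apply, Matrix.conjTranspose_apply, this, ← Finset.sum_mul,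
    Matrix.one_apply]
  rw [sum_fin_natCast_zmod fun x => stdAddChar (x * (((l : ℕ) : ZMod n) - ((k : ℕ) : ZMod n))),
    sum_stdAddChar_mul]
  simp only [sub_eq_zero, natCast_fin_inj, eq_comm (a := l)]
  split_ifs <;> simp [hn']

theorem fourierMatrix_mul_conjTranspose (n : ℕ) [NeZero n] :
    fourierMatrix n * (fourierMatrix n)ᴴ = 1 :=
  mul_eq_one_comm.1 (conjTranspose_fourierMatrix_mul n)

/-- The coupling is even on the cyclic group, so its Fourier transform equals its own conjugate and
is real. -/
theorem sum_ringCoupling_mul_stdAddChar (α : ℝ) (n : ℕ) [NeZero n] (k : Fin n) :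
    ∑ d : ZMod n, (ringCoupling α n d : ℂ) * stdAddChar (-d * ((k : ℕ) : ZMod n)) =
      (dispersion α n k : ℂ) := by
  have h1 : ∑ d : ZMod n, (ringCoupling α n d : ℂ) * stdAddChar (-d * ((k : ℕ) : ZMod n)) =
      ∑ d : ZMod n, (ringCoupling α n d : ℂ) * stdAddChar (d * ((k : ℕ) : ZMod n)) := by
    rw [← Equiv.sum_comp (Equiv.neg (ZMod n))]
    simp [ringCoupling_neg]
  have h2 : (starRingEnd ℂ) (∑ d : ZMod n,
      (ringCoupling α n d : ℂ) * stdAddChar (d * ((k : ℕ) : ZMod n))) =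
      ∑ d : ZMod n, (ringCoupling α n d : ℂ) * stdAddChar (d * ((k : ℕ) : ZMod n)) := by
    rw [← h1, map_sum, h1]
    simp only [map_mul, Complex.conj_ofReal, ← AddChar.map_neg_eq_conj, neg_mul, neg_neg]
  rw [h1, ← Complex.conj_eq_iff_re.1 h2]
  simp [dispersion]

theorem ringHamiltonian_mul_fourierMatrix (α : ℝ) (n : ℕ) [NeZero n] :
    ringHamiltonian α n * fourierMatrix n =
      fourierMatrix n * Matrix.diagonal fun k => (dispersion α n k : ℂ) := by
  ext i k
  rw [Matrix.mul_diagonal, Matrix.mul_apply, ← sum_ringCoupling_mul_stdAddChar, Finset.mul_sum]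
  simp only [ringHamiltonian_apply, fourierMatrix, Matrix.of_apply]
  rw [sum_fin_natCast_zmod fun x => (ringCoupling α n (((i : ℕ) : ZMod n) - x) : ℂ) *
    (stdAddChar (x * ((k : ℕ) : ZMod n)) * ((1 / Real.sqrt n : ℝ) : ℂ)),
    ← Equiv.sum_comp (Equiv.subLeft ((i : ℕ) : ZMod n))]
  refine Finset.sum_congr rfl fun d _ => ?_
  rw [Equiv.subLeft_apply, sub_sub_cancel, sub_mul, sub_eq_add_neg, AddChar.map_add_eq_mul,
    neg_mul]
  ring

theorem ringHamiltonian_eq (α : ℝ) (n : ℕ) [NeZero n] :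
    ringHamiltonian α n = fourierMatrix n * Matrix.diagonal (fun k => (dispersion α n k : ℂ)) *
      (fourierMatrix n)ᴴ := by
  rw [← ringHamiltonian_mul_fourierMatrix, mul_assoc, fourierMatrix_mul_conjTranspose, mul_one]

/-- Both sides are the roots of the characteristic polynomial. Only multisets can be compared, since
the dispersion relation is not sorted. -/
theorem map_dispersion_eq_map_eigenvalues₀ (α : ℝ) (n : ℕ) [NeZero n] :
    (Finset.univ.val.map (dispersion α n)) =
      Finset.univ.val.map (ringHamiltonian_isHermitian α n).eigenvalues₀ := by
  have h := (ringHamiltonian_isHermitian α n).roots_charpoly_eq_eigenvalues₀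
  have hc : (ringHamiltonian α n).charpoly =
      ∏ k, (Polynomial.X - Polynomial.C (dispersion α n k : ℂ)) := by
    rw [ringHamiltonian_eq, mul_assoc, Matrix.charpoly_mul_comm, mul_assoc,
      conjTranspose_fourierMatrix_mul, mul_one, Matrix.charpoly_diagonal]
  rw [hc, Polynomial.roots_prod _ _
    (Finset.prod_ne_zero_iff.2 fun i _ => Polynomial.X_sub_C_ne_zero _)] at h
  simp only [Polynomial.roots_X_sub_C, Multiset.bind_singleton] at h
  have h' := congrArg (Multiset.map Complex.re) h
  simpa [Multiset.map_map, Function.comp_def] using h'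

theorem sum_eigenvalues₀ {M : Type*} [AddCommMonoid M] (α : ℝ) (n : ℕ) [NeZero n] (f : ℝ → M) :
    ∑ i, f ((ringHamiltonian_isHermitian α n).eigenvalues₀ i) = ∑ k, f (dispersion α n k) := by
  have h := congrArg (fun s => (s.map f).sum) (map_dispersion_eq_map_eigenvalues₀ α n)
  simp only [Multiset.map_map] at h
  exact h.symm

end LongRangeSearch

/-! ### Bounds on the dispersion relation -/

namespace LongRangeSearch

open Finset ZMod

theorem val_cast_pos_of_ne_zero {n : ℕ} [NeZero n] {d : ZMod n} (hd : d ≠ 0) :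
    (1 : ℝ) ≤ d.val ∧ (1 : ℝ) ≤ (n : ℝ) - d.val := by
  have h1 : 1 ≤ d.val := Nat.one_le_iff_ne_zero.2 (by simpa using hd)
  have h2 : d.val + 1 ≤ n := d.val_lt
  have h2' : (d.val : ℝ) + 1 ≤ n := by exact_mod_cast h2
  exact ⟨by exact_mod_cast h1, by linarith⟩

theorem ringCoupling_nonneg (α : ℝ) {n : ℕ} (d : ZMod n) :
    0 ≤ ringCoupling α n d := by
  unfold ringCoupling coupling
  split_ifs <;> positivity

theorem ringCoupling_le_two {α : ℝ} (hα : 0 ≤ α) {n : ℕ} [NeZero n] (d : ZMod n) :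
    ringCoupling α n d ≤ 2 := by
  unfold ringCoupling coupling
  split_ifs with h
  · norm_num
  · obtain ⟨h1, h2⟩ := val_cast_pos_of_ne_zero h
    rw [abs_of_pos (by linarith)]
    have := one_div_le_one_div_of_le one_pos (Real.one_le_rpow h1 hα)
    have := one_div_le_one_div_of_le one_pos (Real.one_le_rpow h2 hα)
    linarith

theorem le_ringCoupling {α : ℝ} (hα : 0 ≤ α) {n : ℕ} [NeZero n] {d : ZMod n} (hd : d ≠ 0) :
    2 * (n : ℝ) ^ (-α) ≤ ringCoupling α n d := by
  rw [ringCoupling, if_neg hd, coupling]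
  obtain ⟨h1, h2⟩ := val_cast_pos_of_ne_zero hd
  rw [abs_of_pos (by linarith), Real.rpow_neg (by positivity), ← one_div]
  have := one_div_le_one_div_of_le (Real.rpow_pos_of_pos (by linarith) α)
    (Real.rpow_le_rpow (z := α) (by linarith) (show (d.val : ℝ) ≤ n by linarith) hα)
  have := one_div_le_one_div_of_le (Real.rpow_pos_of_pos (by linarith) α)
    (Real.rpow_le_rpow (z := α) (by linarith) (show (n : ℝ) - d.val ≤ n by linarith) hα)
  linarith

theorem dispersion_zero (α : ℝ) (n : ℕ) [NeZero n] :
    dispersion α n 0 = ∑ d, ringCoupling α n d := by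
  simp [dispersion]

theorem abs_dispersion_le (α : ℝ) (n : ℕ) [NeZero n] (k : Fin n) :
    |dispersion α n k| ≤ dispersion α n 0 := by
  rw [dispersion_zero]
  refine (abs_sum_le_sum_abs _ _).trans (sum_le_sum fun d _ => ?_)
  rw [abs_mul, abs_of_nonneg (ringCoupling_nonneg α d)]
  refine mul_le_of_le_one_right (ringCoupling_nonneg α d) ((Complex.abs_re_le_norm _).trans ?_)
  rw [AddChar.norm_apply]

/-- The gap is $\sum_d J_d(1-\cos(2\pi dk/n))$ with nonnegative terms. Replacing each $J_d$ by its
lower bound $2n^{-\alpha}$ leaves a character sum equal to $n$, uniformly in $k\ne0$. -/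
theorem dispersion_gap {α : ℝ} (hα : 0 ≤ α) (n : ℕ) [NeZero n] {k : Fin n} (hk : k ≠ 0) :
    2 * (n : ℝ) ^ (1 - α) ≤ dispersion α n 0 - dispersion α n k := by
  have hn : (0 : ℝ) < n := by exact_mod_cast NeZero.pos n
  have hk' : ((k : ℕ) : ZMod n) ≠ 0 := fun h => hk <| natCast_fin_inj.1 (by simpa using h)
  have hsum : ∑ d : ZMod n, (1 - (stdAddChar (d * ((k : ℕ) : ZMod n))).re) = n := by
    rw [sum_sub_distrib, ← Complex.re_sum, sum_stdAddChar_mul, if_neg hk']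
    simp [ZMod.card]
  rw [dispersion_zero, dispersion, ← sum_sub_distrib, sub_eq_add_neg 1 α, Real.rpow_add hn,
    Real.rpow_one]
  calc 2 * ((n : ℝ) * (n : ℝ) ^ (-α))
      = ∑ d : ZMod n, 2 * (n : ℝ) ^ (-α) * (1 - (stdAddChar (d * ((k : ℕ) : ZMod n))).re) := by
        rw [← mul_sum, hsum]; ring
    _ ≤ _ := sum_le_sum fun d _ => ?_
  rw [← mul_one_sub]
  by_cases hd : d = 0
  · simp [hd]
  · refine mul_le_mul_of_nonneg_right (le_ringCoupling hα hd) (sub_nonneg.2 ?_)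
    exact (Complex.re_le_norm _).trans (AddChar.norm_apply _ _).le

theorem sum_range_one_div_rpow_le {α : ℝ} (hα0 : 0 ≤ α) (hα1 : α < 1) (m : ℕ) :
    ∑ r ∈ range m, 1 / ((r : ℝ) + 1) ^ α ≤ (m : ℝ) ^ (1 - α) / (1 - α) := by
  have h1 : 0 < 1 - α := by linarith
  induction m with
  | zero => simp [Real.zero_rpow h1.ne']
  | succ m ih =>
    have hm : (0 : ℝ) < m + 1 := by positivity
    -- Bernoulli at $s=-1/(m+1)$: concavity of $x^{1-\alpha}$ bounds the new term by the increment
    -- of the right-hand side.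
    have hb := rpow_one_add_le_one_add_mul_self (s := -1 / ((m : ℝ) + 1)) (p := 1 - α)
      (by rw [le_div_iff₀ hm]; linarith [(Nat.cast_nonneg m : (0 : ℝ) ≤ m)]) h1.le (by linarith)
    have hs : (1 : ℝ) + -1 / ((m : ℝ) + 1) = m / (m + 1) := by field_simp; ring
    rw [hs, Real.div_rpow (by positivity) hm.le, div_le_iff₀ (by positivity)] at hb
    have hp : ((m : ℝ) + 1) ^ (1 - α) / (m + 1) = 1 / ((m : ℝ) + 1) ^ α := by
      rw [Real.rpow_sub hm, Real.rpow_one]; field_simp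
    rw [sum_range_succ, ← hp]
    have : ((m : ℝ) + 1) ^ (1 - α) / (m + 1) ≤
        (((m : ℝ) + 1) ^ (1 - α) - (m : ℝ) ^ (1 - α)) / (1 - α) := by
      rw [le_div_iff₀ h1]
      have e : (1 + (1 - α) * (-1 / ((m : ℝ) + 1))) * ((m : ℝ) + 1) ^ (1 - α) =
        ((m : ℝ) + 1) ^ (1 - α) - ((m : ℝ) + 1) ^ (1 - α) / (m + 1) * (1 - α) := by
        field_simp; ring
      linarith
    push_cast
    rw [sub_div] at this
    linarith

/-- The two terms of the coupling are reflections of each other in $r\mapsto n-r$, so they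
contribute equal sums. -/
theorem sum_ringCoupling (α : ℝ) (m : ℕ) :
    ∑ d : ZMod (m + 1), ringCoupling α (m + 1) d =
      2 * ∑ r ∈ range m, 1 / ((r : ℝ) + 1) ^ α := by
  have h1 : ∀ r : ℕ, r ∈ range m → ringCoupling α (m + 1) (((r + 1 : ℕ)) : ZMod (m + 1)) =
      1 / ((r : ℝ) + 1) ^ α + 1 / (((m - 1 - r : ℕ) : ℝ) + 1) ^ α := by
    intro r hr
    have hr' := mem_range.1 hr
    have hv : (((r + 1 : ℕ)) : ZMod (m + 1)).val = r + 1 := ZMod.val_cast_of_lt (by omega)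
    have hne : (((r + 1 : ℕ)) : ZMod (m + 1)) ≠ 0 := by
      intro h
      rw [h, ZMod.val_zero] at hv
      omega
    rw [ringCoupling, if_neg hne, hv, coupling, ← Nat.cast_sub (by omega), Nat.abs_cast,
      show m + 1 - (r + 1) = m - 1 - r + 1 by omega]
    push_cast
    rfl
  rw [← sum_fin_natCast_zmod, Fin.sum_univ_eq_sum_range
    (fun r => ringCoupling α (m + 1) ((r : ℕ) : ZMod (m + 1))), sum_range_succ', sum_congr rfl h1,
    sum_add_distrib, sum_range_reflect (fun r => 1 / ((r : ℝ) + 1) ^ α)]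
  simp [ringCoupling, two_mul]

theorem dispersion_zero_le {α : ℝ} (hα0 : 0 ≤ α) (hα1 : α < 1) (n : ℕ) [NeZero n] :
    dispersion α n 0 ≤ 2 * (n : ℝ) ^ (1 - α) / (1 - α) := by
  obtain ⟨m, rfl⟩ := Nat.exists_eq_succ_of_ne_zero (NeZero.ne n)
  have h1 : 0 < 1 - α := by linarith
  rw [dispersion_zero, sum_ringCoupling, mul_div_assoc]
  refine mul_le_mul_of_nonneg_left ((sum_range_one_div_rpow_le hα0 hα1 m).trans ?_) zero_le_two
  gcongr
  simp

/-- The trace of $H^2$, computed in the Fourier basis and in the site basis. -/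
theorem sum_dispersion_sq (α : ℝ) (n : ℕ) [NeZero n] :
    ∑ k, dispersion α n k ^ 2 = n * ∑ d, ringCoupling α n d ^ 2 := by
  have h1 : (ringHamiltonian α n * ringHamiltonian α n).trace =
      ((∑ k, dispersion α n k ^ 2 : ℝ) : ℂ) := by
    have h : ringHamiltonian α n * ringHamiltonian α n = fourierMatrix n *
        (Matrix.diagonal (fun k => (dispersion α n k : ℂ)) *
          Matrix.diagonal fun k => (dispersion α n k : ℂ)) * (fourierMatrix n)ᴴ := by
      conv_lhs => rw [ringHamiltonian_eq α n, ← mul_assoc, ← mul_assoc, ← ringHamiltonian_eq, ringHamiltonian_mul_fourierMatrix,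
        mul_assoc (fourierMatrix n)]
    rw [h, mul_assoc, Matrix.trace_mul_comm, mul_assoc, conjTranspose_fourierMatrix_mul, mul_one,
      Matrix.diagonal_mul_diagonal, Matrix.trace_diagonal]
    push_cast
    simp [sq]
  have h2 : (ringHamiltonian α n * ringHamiltonian α n).trace =
      ((n * ∑ d, ringCoupling α n d ^ 2 : ℝ) : ℂ) := by
    have h : ∀ i : Fin n, ∑ j : Fin n, ringHamiltonian α n i j * ringHamiltonian α n j i =
        ((∑ d, ringCoupling α n d ^ 2 : ℝ) : ℂ) := by
      intro i
      rw [← Equiv.sum_comp (Equiv.subLeft ((i : ℕ) : ZMod n)), ← sum_fin_natCast_zmod]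
      push_cast
      refine sum_congr rfl fun j _ => ?_
      rw [ringHamiltonian_apply, ringHamiltonian_apply, Equiv.subLeft_apply,
        ← neg_sub (((i : ℕ) : ZMod n)), ringCoupling_neg, sq]
    simp only [Matrix.trace, Matrix.diag, Matrix.mul_apply, h]
    simp
  exact_mod_cast h1.symm.trans h2

theorem sum_dispersion_sq_le {α : ℝ} (hα : 0 ≤ α) (n : ℕ) [NeZero n] :
    ∑ k, dispersion α n k ^ 2 ≤ 2 * n * dispersion α n 0 := by
  rw [sum_dispersion_sq, dispersion_zero, mul_comm 2 (n : ℝ), mul_assoc]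
  refine mul_le_mul_of_nonneg_left ?_ (Nat.cast_nonneg n)
  rw [mul_sum]
  refine sum_le_sum fun d _ => ?_
  rw [sq]
  exact mul_le_mul_of_nonneg_right (ringCoupling_le_two hα d) (ringCoupling_nonneg α d)

end LongRangeSearch

/-! ### The ordered spectrum -/

namespace LongRangeSearch

open Finset

theorem exists_eigenvalues₀_eq (α : ℝ) (n : ℕ) [NeZero n] (k : Fin n) :
    ∃ i, (ringHamiltonian_isHermitian α n).eigenvalues₀ i = dispersion α n k := by
  have : dispersion α n k ∈ univ.val.map (dispersion α n) :=
    Multiset.mem_map_of_mem _ (mem_univ k)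
  rw [map_dispersion_eq_map_eigenvalues₀, Multiset.mem_map] at this
  exact this.imp fun _ h => h.2

theorem exists_dispersion_eq (α : ℝ) (n : ℕ) [NeZero n] (i : Fin (Fintype.card (Fin n))) :
    ∃ k, dispersion α n k = (ringHamiltonian_isHermitian α n).eigenvalues₀ i := by
  have : (ringHamiltonian_isHermitian α n).eigenvalues₀ i ∈
      univ.val.map (ringHamiltonian_isHermitian α n).eigenvalues₀ :=
    Multiset.mem_map_of_mem _ (mem_univ i)
  rw [← map_dispersion_eq_map_eigenvalues₀, Multiset.mem_map] at this
  exact this.imp fun _ h => h.2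

theorem exists_ringEigenvalue_eq (α : ℝ) {n i : ℕ} [NeZero n] (hi : 1 ≤ i) :
    ∃ k, dispersion α n k = ringEigenvalue α n i := by
  have hn := NeZero.pos n
  rw [ringEigenvalue, dif_pos (by omega)]
  exact exists_dispersion_eq α n _

theorem ringEigenvalue_top (α : ℝ) (n : ℕ) [NeZero n] :
    ringEigenvalue α n n = dispersion α n 0 := by
  have hn := NeZero.pos n
  obtain ⟨k, hk⟩ := exists_ringEigenvalue_eq α (n := n) (i := n) hn
  refine le_antisymm (hk ▸ (le_abs_self _).trans (abs_dispersion_le α n k)) ?_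
  obtain ⟨i, hi⟩ := exists_eigenvalues₀_eq α n 0
  rw [ringEigenvalue, dif_pos (by omega), ← hi]
  exact (ringHamiltonian_isHermitian α n).eigenvalues₀_antitone (Fin.le_def.2 (by simp))

theorem dispersion_lt {α : ℝ} (hα : 0 ≤ α) (n : ℕ) [NeZero n] {k : Fin n} (hk : k ≠ 0) :
    dispersion α n k < dispersion α n 0 := by
  have := dispersion_gap hα n hk
  have : 0 < (n : ℝ) ^ (1 - α) := Real.rpow_pos_of_pos (by exact_mod_cast NeZero.pos n) _
  linarith

/-- The top eigenvalue is simple, so an ordered eigenvalue of index below $n$ belongs to a nonzero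
wave number, where the gap bound applies. -/
theorem ringEigenvalue_le {α : ℝ} (hα : 0 ≤ α) {n i : ℕ} [NeZero n] (h1 : 1 ≤ i) (hi : i < n) :
    ringEigenvalue α n i ≤ dispersion α n 0 - 2 * (n : ℝ) ^ (1 - α) := by
  classical
  obtain ⟨k, hk⟩ := exists_ringEigenvalue_eq α (n := n) h1
  have hne : k ≠ 0 := by
    rintro rfl
    -- Counts multiplicity: exactly one sorted index carries $E_0$, and the last one already does,
    -- so index $i<n$ would give a second.
    have hcount := sum_eigenvalues₀ α n fun x => if x = dispersion α n 0 then 1 else 0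
    have hk0 : ∀ k, dispersion α n k = dispersion α n 0 ↔ k = 0 := fun k =>
      ⟨fun h => by_contra fun hk => (dispersion_lt hα n hk).ne h, fun h => h ▸ rfl⟩
    simp only [hk0, sum_boole, filter_eq', mem_univ, if_true, card_singleton, Nat.cast_id] at hcount
    have htop := ringEigenvalue_top α n
    rw [ringEigenvalue, dif_pos (by omega)] at hk htop
    have := card_le_one.1 hcount.le _ (mem_filter.2 ⟨mem_univ _, hk.symm⟩) _
      (mem_filter.2 ⟨mem_univ _, htop⟩)
    have := congrArg Fin.val this
    simp only at this
    omega
  rw [← hk]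
  linarith [dispersion_gap hα n hne]

/-- Turns the sums over ordered eigenvalues below the top into sums over all wave numbers; the
hypothesis on `f` makes the extra top term vanish. -/
theorem sum_ringEigenvalue {M : Type*} [AddCommMonoid M] (α : ℝ) (n : ℕ) [NeZero n] (f : ℝ → M)
    (hf : f (dispersion α n 0) = 0) :
    ∑ i ∈ Icc 1 (n - 1), f (ringEigenvalue α n i) = ∑ k, f (dispersion α n k) := by
  have h : ∀ i, (ringHamiltonian_isHermitian α n).eigenvalues₀ i =
      ringEigenvalue α n (n - (i : ℕ)) := by
    intro i
    have hi : (i : ℕ) < n := i.is_lt.trans_eq (Fintype.card_fin n)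
    rw [ringEigenvalue, dif_pos (by omega)]
    congr 1
    ext
    simp only
    omega
  rw [← sum_eigenvalues₀, sum_congr rfl fun i _ => congrArg f (h i),
    Fin.sum_univ_eq_sum_range (fun j => f (ringEigenvalue α n (n - j))), Fintype.card_fin]
  obtain ⟨m, rfl⟩ := Nat.exists_eq_succ_of_ne_zero (NeZero.ne n)
  rw [sum_range_succ', Nat.sub_zero, ringEigenvalue_top, hf, add_zero,
    ← sum_range_reflect, Nat.succ_sub_one, ← Ico_add_one_right_eq_Icc, sum_Ico_eq_sum_range]
  refine sum_congr (by simp) fun j hj => ?_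
  have := mem_range.1 hj
  congr 2
  simp only [Nat.succ_eq_add_one] at *
  omega

/-! ### Resolvent moments and the asymptotic fidelity -/

theorem ringEigenvalue_one_lt_top {α : ℝ} (hα : 0 ≤ α) {n : ℕ} [NeZero n] (hn : 2 ≤ n) :
    ringEigenvalue α n 1 < ringEigenvalue α n n := by
  have := ringEigenvalue_le hα (n := n) le_rfl (by omega)
  have : 0 < (n : ℝ) ^ (1 - α) := Real.rpow_pos_of_pos (by exact_mod_cast NeZero.pos n) _
  rw [ringEigenvalue_top]
  linarith

theorem one_sub_rescaledEigenvalue {α : ℝ} (hα : 0 ≤ α) {n : ℕ} [NeZero n] (hn : 2 ≤ n) (i : ℕ) :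
    1 - rescaledEigenvalue α n i = (dispersion α n 0 - ringEigenvalue α n i) /
      (ringEigenvalue α n n - ringEigenvalue α n 1) := by
  have := sub_pos.2 (ringEigenvalue_one_lt_top hα hn)
  rw [rescaledEigenvalue, ← ringEigenvalue_top]
  field_simp
  ring

/-- The normalized moments of the reduced resolvent of the ring at its largest eigenvalue. -/
noncomputable def resolventMoment (α : ℝ) (n q : ℕ) [NeZero n] : ℝ :=
  1 / (n : ℝ) * ∑ k, (dispersion α n 0 - dispersion α n k)⁻¹ ^ q

theorem spectralSum_eq {α : ℝ} (hα : 0 ≤ α) {n q : ℕ} [NeZero n] (hn : 2 ≤ n) (hq : q ≠ 0) :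
    spectralSum α n q =
      (ringEigenvalue α n n - ringEigenvalue α n 1) ^ q * resolventMoment α n q := by
  have h : ∀ i, 1 / (1 - rescaledEigenvalue α n i) ^ q =
      (ringEigenvalue α n n - ringEigenvalue α n 1) ^ q *
        (dispersion α n 0 - ringEigenvalue α n i)⁻¹ ^ q := by
    intro i
    rw [one_sub_rescaledEigenvalue hα hn, ← mul_pow, one_div, ← inv_pow, inv_div, div_eq_mul_inv]
  rw [spectralSum, resolventMoment, sum_congr rfl fun i _ => h i, ← mul_sum,
    -- Since `0⁻¹ = 0` and $q\ne0$, the top eigenvalue contributes nothing: the plain inverse serves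
    -- as the reduced resolvent.
    sum_ringEigenvalue α n (fun x => (dispersion α n 0 - x)⁻¹ ^ q) (by simp [hq])]
  ring

/-- The ratio is homogeneous of degree zero, so the rescaling by $\lambda_n-\lambda_1$ cancels. -/
theorem asymptoticFidelity_eq {α : ℝ} (hα : 0 ≤ α) {n : ℕ} [NeZero n] (hn : 2 ≤ n) :
    asymptoticFidelity α n = resolventMoment α n 1 ^ 2 / resolventMoment α n 2 := by
  have := sub_pos.2 (ringEigenvalue_one_lt_top hα hn)
  rw [asymptoticFidelity, spectralSum_eq hα hn one_ne_zero, spectralSum_eq hα hn two_ne_zero,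
    pow_one, mul_pow, mul_div_mul_left _ _ (by positivity)]

theorem resolventMoment_pos {α : ℝ} (hα : 0 ≤ α) {n q : ℕ} [NeZero n] (hn : 2 ≤ n) :
    0 < resolventMoment α n q := by
  have h0 : (0 : ℝ) < n := by exact_mod_cast NeZero.pos n
  refine mul_pos (by positivity) (sum_pos' (fun k _ => pow_nonneg (inv_nonneg.2 ?_) q)
    ⟨⟨1, hn⟩, mem_univ _, pow_pos (inv_pos.2 (sub_pos.2 (dispersion_lt hα n ?_))) q⟩)
  · exact sub_nonneg.2 ((le_abs_self _).trans (abs_dispersion_le α n k))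
  · exact fun h => absurd (congrArg Fin.val h) (by simp)

/-- The gap is at least $2n^{1-\alpha}$ and the width of the spectrum at most $2E_0\le
4n^{1-\alpha}/(1-\alpha)$. -/
theorem le_spectralGap {α : ℝ} (hα0 : 0 ≤ α) (hα1 : α < 1) {n : ℕ} (hn : 2 ≤ n) :
    (1 - α) / 2 ≤ spectralGap α n := by
  have : NeZero n := ⟨by omega⟩
  have h1 : 0 < 1 - α := by linarith
  have hD := sub_pos.2 (ringEigenvalue_one_lt_top hα0 hn)
  rw [spectralGap, one_sub_rescaledEigenvalue hα0 hn, le_div_iff₀ hD]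
  have hg := ringEigenvalue_le hα0 (n := n) (i := n - 1) (by omega) (by omega)
  obtain ⟨k, hk⟩ := exists_ringEigenvalue_eq α (n := n) le_rfl
  have hl := (abs_le.1 (abs_dispersion_le α n k)).1
  have hu := dispersion_zero_le hα0 hα1 n
  rw [le_div_iff₀ h1] at hu
  rw [← hk, ringEigenvalue_top]
  nlinarith

theorem rescaledEigenvalue_nonneg {α : ℝ} (hα : 0 ≤ α) {n i : ℕ} (hn : 2 ≤ n) (hi : 1 ≤ i) :
    0 ≤ rescaledEigenvalue α n i := by
  have : NeZero n := ⟨by omega⟩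
  refine div_nonneg (sub_nonneg.2 ?_) (sub_nonneg.2 (ringEigenvalue_one_lt_top hα hn).le)
  rw [ringEigenvalue, ringEigenvalue, dif_pos (by omega), dif_pos (by omega)]
  exact (ringHamiltonian_isHermitian α n).eigenvalues₀_antitone
    (Fin.le_def.2 (by simp only; omega))

theorem rescaledEigenvalue_le {α : ℝ} (hα : 0 ≤ α) {n i : ℕ} (hn : 2 ≤ n) (h1 : 1 ≤ i) (hi : i ≤ n - 1) :
    rescaledEigenvalue α n i ≤ rescaledEigenvalue α n (n - 1) := by
  have : NeZero n := ⟨by omega⟩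
  refine div_le_div_of_nonneg_right (sub_le_sub_right ?_ _)
    (sub_nonneg.2 (ringEigenvalue_one_lt_top hα hn).le)
  rw [ringEigenvalue, ringEigenvalue, dif_pos (by omega), dif_pos (by omega)]
  exact (ringHamiltonian_isHermitian α n).eigenvalues₀_antitone
    (Fin.le_def.2 (by simp only; omega))

theorem spectralGap_le_one {α : ℝ} (hα : 0 ≤ α) {n : ℕ} (hn : 2 ≤ n) : spectralGap α n ≤ 1 := by
  rw [spectralGap]
  linarith [rescaledEigenvalue_nonneg hα hn (show 1 ≤ n - 1 by omega)]

/-- The defining variational property of the asymptotic fidelity. -/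
theorem one_sub_asymptoticFidelity_le {α : ℝ} (hα : 0 ≤ α) {n : ℕ} [NeZero n] (hn : 2 ≤ n) (x : ℝ) :
    1 - asymptoticFidelity α n ≤
      1 / (n : ℝ) * ∑ k, (1 - x * (dispersion α n 0 - dispersion α n k)⁻¹) ^ 2 := by
  have h2 := resolventMoment_pos hα (q := 2) hn
  have h0 : (0 : ℝ) < n := by exact_mod_cast NeZero.pos n
  have e : 1 / (n : ℝ) * ∑ k, (1 - x * (dispersion α n 0 - dispersion α n k)⁻¹) ^ 2 =
      1 - 2 * x * resolventMoment α n 1 + x ^ 2 * resolventMoment α n 2 := by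
    have : ∀ k, (1 - x * (dispersion α n 0 - dispersion α n k)⁻¹) ^ 2 =
        1 - 2 * x * (dispersion α n 0 - dispersion α n k)⁻¹ ^ 1 +
          x ^ 2 * (dispersion α n 0 - dispersion α n k)⁻¹ ^ 2 := fun k => by ring
    simp only [this, sum_add_distrib, sum_sub_distrib, ← mul_sum, resolventMoment]
    simp
    field_simp
  rw [e, asymptoticFidelity_eq hα hn]
  -- Completing the square in `x`: this quantity is the difference of the two sides.
  have : 0 ≤ (resolventMoment α n 1 - x * resolventMoment α n 2) ^ 2 / resolventMoment α n 2 := by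
    positivity
  have e2 : (resolventMoment α n 1 - x * resolventMoment α n 2) ^ 2 / resolventMoment α n 2 =
      resolventMoment α n 1 ^ 2 / resolventMoment α n 2 - 2 * x * resolventMoment α n 1 +
        x ^ 2 * resolventMoment α n 2 := by
    field_simp
    ring
  linarith

theorem asymptoticFidelity_le_one {α : ℝ} (hα : 0 ≤ α) {n : ℕ} (hn : 2 ≤ n) :
    asymptoticFidelity α n ≤ 1 := by
  have : NeZero n := ⟨by omega⟩
  have h2 := resolventMoment_pos hα (q := 2) hn
  have h0 : (0 : ℝ) < n := by exact_mod_cast NeZero.pos n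
  rw [asymptoticFidelity_eq hα hn, div_le_one h2]
  -- Cauchy–Schwarz against the constant function.
  have := sq_sum_le_card_mul_sum_sq (s := (univ : Finset (Fin n)))
    (f := fun k => (dispersion α n 0 - dispersion α n k)⁻¹)
  rw [card_univ, Fintype.card_fin] at this
  simp only [resolventMoment, pow_one, mul_pow]
  calc (1 / (n : ℝ)) ^ 2 * _ ≤ (1 / (n : ℝ)) ^ 2 * _ :=
        mul_le_mul_of_nonneg_left this (by positivity)
    _ = _ := by field_simp

/-- Each $1-\tilde\lambda_i$ lies in $[\Delta,1]$, which gives $S_1\ge 1-1/n$ and $\Delta S_2\le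
S_1$ term by term. -/
theorem spectralGap_mul_le_asymptoticFidelity {α : ℝ} (hα0 : 0 ≤ α) (hα1 : α < 1) {n : ℕ}
    (hn : 2 ≤ n) : spectralGap α n * (1 - 1 / (n : ℝ)) ≤ asymptoticFidelity α n := by
  have : NeZero n := ⟨by omega⟩
  have h0 : (0 : ℝ) < n := by exact_mod_cast NeZero.pos n
  have hΔ : 0 < spectralGap α n := (by linarith : 0 < (1 - α) / 2).trans_le
    (le_spectralGap hα0 hα1 hn)
  have hD := sub_pos.2 (ringEigenvalue_one_lt_top hα0 hn)
  have hS2 : 0 < spectralSum α n 2 := by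
    rw [spectralSum_eq hα0 hn two_ne_zero]
    exact mul_pos (pow_pos hD 2) (resolventMoment_pos hα0 hn)
  have hS1 : 0 < spectralSum α n 1 := by
    rw [spectralSum_eq hα0 hn one_ne_zero]
    exact mul_pos (pow_pos hD 1) (resolventMoment_pos hα0 hn)
  have hx : ∀ i ∈ Icc 1 (n - 1), spectralGap α n ≤ 1 - rescaledEigenvalue α n i ∧
      1 - rescaledEigenvalue α n i ≤ 1 := by
    intro i hi
    obtain ⟨hi1, hi2⟩ := mem_Icc.1 hi
    rw [spectralGap]
    exact ⟨sub_le_sub_left (rescaledEigenvalue_le hα0 hn hi1 hi2) 1,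
      sub_le_self _ (rescaledEigenvalue_nonneg hα0 hn hi1)⟩
  have h1 : 1 - 1 / (n : ℝ) ≤ spectralSum α n 1 := by
    have : (∑ i ∈ Icc 1 (n - 1), (1 : ℝ)) ≤
        ∑ i ∈ Icc 1 (n - 1), 1 / (1 - rescaledEigenvalue α n i) ^ 1 := by
      refine sum_le_sum fun i hi => ?_
      obtain ⟨ha, hb⟩ := hx i hi
      rw [pow_one, le_div_iff₀ (hΔ.trans_le ha), one_mul]
      exact hb
    rw [spectralSum]
    calc 1 - 1 / (n : ℝ) = 1 / (n : ℝ) * ∑ i ∈ Icc 1 (n - 1), (1 : ℝ) := by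
          rw [sum_const, Nat.card_Icc, nsmul_eq_mul, Nat.add_sub_cancel,
            Nat.cast_sub (by omega)]
          field_simp
          simp
      _ ≤ _ := mul_le_mul_of_nonneg_left this (by positivity)
  have h2 : spectralGap α n * spectralSum α n 2 ≤ spectralSum α n 1 := by
    rw [spectralSum, spectralSum, mul_left_comm, mul_sum]
    refine mul_le_mul_of_nonneg_left (sum_le_sum fun i hi => ?_) (by positivity)
    obtain ⟨ha, hb⟩ := hx i hi
    have := hΔ.trans_le ha
    rw [pow_one, sq, mul_one_div, div_le_div_iff₀ (by positivity) this]
    nlinarith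
  rw [asymptoticFidelity, le_div_iff₀ hS2]
  calc spectralGap α n * (1 - 1 / (n : ℝ)) * spectralSum α n 2
      ≤ spectralGap α n * spectralSum α n 1 * spectralSum α n 2 := by gcongr
    _ = spectralGap α n * spectralSum α n 2 * spectralSum α n 1 := by ring
    _ ≤ spectralSum α n 1 * spectralSum α n 1 := by gcongr
    _ = spectralSum α n 1 ^ 2 := (sq _).symm

theorem one_sub_asymptoticFidelity_le_rpow {α : ℝ} (hα0 : 0 ≤ α) (hα1 : α < 1) {n : ℕ}
    (hn : 2 ≤ n) :
    1 - asymptoticFidelity α n ≤ 1 / (n : ℝ) + (1 - α)⁻¹ * (n : ℝ) ^ (-(1 - α)) := by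
  have : NeZero n := ⟨by omega⟩
  have h0 : (0 : ℝ) < n := by exact_mod_cast NeZero.pos n
  have h1 : 0 < 1 - α := by linarith
  set N := (n : ℝ) ^ (1 - α) with hN
  have hNpos : 0 < N := Real.rpow_pos_of_pos h0 _
  -- With $x=E_0$ the summand at $k\ne0$ is $E_k^2/(E_0-E_k)^2$, controlled by the gap and the
  -- second moment of the spectrum. At $k=0$ the inverse is zero and the summand is $1$, whence the
  -- term $1/n$.
  refine (one_sub_asymptoticFidelity_le hα0 hn (dispersion α n 0)).trans ?_
  have hk : ∀ k, (1 - dispersion α n 0 * (dispersion α n 0 - dispersion α n k)⁻¹) ^ 2 ≤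
      (if k = 0 then 1 else 0) + dispersion α n k ^ 2 / (2 * N) ^ 2 := by
    intro k
    split_ifs with h
    · simp only [h, sub_self, inv_zero, mul_zero, sub_zero, one_pow, le_add_iff_nonneg_right]
      positivity
    · have hg := dispersion_gap hα0 n h
      have hg0 : 0 < dispersion α n 0 - dispersion α n k := by linarith
      have : 1 - dispersion α n 0 * (dispersion α n 0 - dispersion α n k)⁻¹ =
          -dispersion α n k / (dispersion α n 0 - dispersion α n k) := by
        field_simp
        ring
      rw [this, div_pow, neg_sq, zero_add]
      gcongr
  calc _ ≤ 1 / (n : ℝ) * (1 + 2 * n * dispersion α n 0 / (2 * N) ^ 2) := by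
        refine mul_le_mul_of_nonneg_left ((sum_le_sum fun k _ => hk k).trans ?_) (by positivity)
        rw [sum_add_distrib, ← sum_div]
        simp only [sum_ite_eq', mem_univ, if_true]
        gcongr
        exact sum_dispersion_sq_le hα0 n
    _ ≤ 1 / (n : ℝ) * (1 + 2 * n * (2 * N / (1 - α)) / (2 * N) ^ 2) := by
        gcongr
        exact dispersion_zero_le hα0 hα1 n
    _ = _ := by
        rw [Real.rpow_neg h0.le, ← hN]
        field_simp

theorem tendsto_asymptoticFidelity {α : ℝ} (hα0 : 0 ≤ α) (hα1 : α < 1) :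
    Tendsto (fun n : ℕ => asymptoticFidelity α n) atTop (𝓝 1) := by
  have h : Tendsto (fun n : ℕ => 1 - (1 / (n : ℝ) + (1 - α)⁻¹ * (n : ℝ) ^ (-(1 - α)))) atTop
      (𝓝 1) := by
    have h2 := ((tendsto_rpow_neg_atTop (sub_pos.2 hα1)).comp
      tendsto_natCast_atTop_atTop).const_mul (1 - α)⁻¹
    simpa using (tendsto_one_div_atTop_nhds_zero_nat.add h2).const_sub (1 : ℝ)
  refine tendsto_of_tendsto_of_tendsto_of_le_of_le' h tendsto_const_nhds ?_ ?_
  · filter_upwards [eventually_ge_atTop 2] with n hn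
    linarith [one_sub_asymptoticFidelity_le_rpow hα0 hα1 hn]
  · filter_upwards [eventually_ge_atTop 2] with n hn
    exact asymptoticFidelity_le_one hα0 hn

end LongRangeSearch

/-! ### Duhamel's estimate and the approximate rotation -/

namespace LongRangeSearch

section Duhamel

variable {E : Type*} [NormedAddCommGroup E] [InnerProductSpace ℂ E] [CompleteSpace E]

theorem smul_I_smul_mem_skewAdjoint {B : E →L[ℂ] E} (hB : IsSelfAdjoint B) (t : ℝ) :
    t • (Complex.I • B) ∈ skewAdjoint (E →L[ℂ] E) := by
  rw [skewAdjoint.mem_iff, star_smul, star_smul, hB.star_eq]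
  simp

theorem exp_smul_I_smul_mem_unitary {B : E →L[ℂ] E} (hB : IsSelfAdjoint B) (t : ℝ) :
    NormedSpace.exp (t • (Complex.I • B)) ∈ unitary (E →L[ℂ] E) := by
  let +nondep _ : NormedAlgebra ℚ (E →L[ℂ] E) := .restrictScalars ℚ ℂ _
  exact NormedSpace.exp_mem_unitary_of_mem_skewAdjoint (smul_I_smul_mem_skewAdjoint hB t)

theorem norm_exp_smul_I_smul {B : E →L[ℂ] E} (hB : IsSelfAdjoint B) (t : ℝ) (x : E) :
    ‖NormedSpace.exp (t • (Complex.I • B)) x‖ = ‖x‖ :=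
  ContinuousLinearMap.norm_map_of_mem_unitary (exp_smul_I_smul_mem_unitary hB t) x

/-- Duhamel's estimate: an approximate solution of the Schrödinger equation stays close to the exact
one. -/
theorem norm_sub_exp_apply_le {B : E →L[ℂ] E} (hB : IsSelfAdjoint B) {v v' : ℝ → E}
    (hv : ∀ t, HasDerivAt v (v' t) t) {δ : ℝ} (hδ : ∀ t, ‖Complex.I • B (v t) + v' t‖ ≤ δ)
    {T : ℝ} (hT : 0 ≤ T) :
    ‖v T - NormedSpace.exp ((-Complex.I * (T : ℂ)) • B) (v 0)‖ ≤ δ * T := by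
  -- Interaction picture: $e^{itB}v(t)$ has derivative $e^{itB}(iBv+v')$, whose norm is that of the
  -- residual because $e^{itB}$ is unitary.
  have hexp : ∀ t : ℝ, HasDerivAt (fun t : ℝ => (NormedSpace.exp (t • (Complex.I • B))) (v t))
      (NormedSpace.exp (t • (Complex.I • B)) (Complex.I • B (v t) + v' t)) t := by
    intro t
    have h := (ContinuousLinearMap.restrictScalarsL ℂ E E ℝ ℝ).hasFDerivAt.comp_hasDerivAt t
      (hasDerivAt_exp_smul_const (𝕂 := ℝ) (Complex.I • B) t)
    have h' := h.clm_apply (hv t)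
    rw [map_add]
    exact h'
  have hle := norm_image_sub_le_of_norm_deriv_le_segment' (a := 0) (b := T) (C := δ)
    (fun t _ => (hexp t).hasDerivWithinAt)
    (fun t _ => by rw [norm_exp_smul_I_smul hB]; exact hδ t) T ⟨hT, le_rfl⟩
  rw [zero_smul, NormedSpace.exp_zero, one_apply_eq_self, sub_zero] at hle
  have hinv : (-Complex.I * (T : ℂ)) • B = (-T) • (Complex.I • B) := by
    rw [mul_smul, neg_smul, neg_smul, smul_comm, Complex.coe_smul]
  rw [hinv]
  have hcancel : ∀ x, NormedSpace.exp ((-T) • (Complex.I • B))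
      (NormedSpace.exp (T • (Complex.I • B)) x) = x := by
    intro x
    let +nondep _ : NormedAlgebra ℚ (E →L[ℂ] E) := .restrictScalars ℚ ℂ _
    rw [← mul_apply_eq_comp, ← NormedSpace.exp_add_of_commute
      ((Commute.refl _).smul_left _ |>.smul_right _), ← add_smul, neg_add_cancel, zero_smul,
      NormedSpace.exp_zero, one_apply_eq_self]
  rw [← hcancel (v T), ← map_sub, norm_exp_smul_I_smul hB]
  exact hle

/-- If `B φ = c φ + κ s` and `B s = c s + κ w`, then the Schrödinger evolution of `s` rotates `s`
into `φ`, up to an error governed by the distance of `w` and `φ`. -/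
theorem norm_rotation_sub_exp_apply_le {B : E →L[ℂ] E} (hB : IsSelfAdjoint B) {s φ w : E}
    {c κ : ℝ} (hκ : 0 < κ) (hφ : B φ = (c : ℂ) • φ + (κ : ℂ) • s)
    (hs : B s = (c : ℂ) • s + (κ : ℂ) • w) :
    ‖(Complex.exp (-Complex.I * c * (Real.pi / 2 / κ : ℝ)) * -Complex.I) • φ -
      NormedSpace.exp ((-Complex.I * ((Real.pi / 2 / κ : ℝ) : ℂ)) • B) s‖ ≤
        Real.pi / 2 * ‖w - φ‖ := by
  have hexp : ∀ t : ℝ, HasDerivAt (fun t : ℝ => Complex.exp (-Complex.I * c * t))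
      (Complex.exp (-Complex.I * c * t) * (-Complex.I * c)) t := fun t => by
    simpa using ((Complex.ofRealCLM.hasDerivAt (x := t)).const_mul (-Complex.I * (c : ℂ))).cexp
  have hlin : ∀ t : ℝ, HasDerivAt (fun t : ℝ => κ * t) κ t := fun t => by
    simpa using (hasDerivAt_id t).const_mul κ
  have hcos : ∀ t : ℝ, HasDerivAt (fun t : ℝ => (Real.cos (κ * t) : ℂ))
      ((-Real.sin (κ * t) * κ : ℝ) : ℂ) t := fun t => (hlin t).cos.ofReal_comp
  have hsin : ∀ t : ℝ, HasDerivAt (fun t : ℝ => (Real.sin (κ * t) : ℂ))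
      ((Real.cos (κ * t) * κ : ℝ) : ℂ) t := fun t => (hlin t).sin.ofReal_comp
  -- The trial solution is $e^{-ict}(\cos(\kappa t)\,s-i\sin(\kappa t)\,\varphi)$, exact if
  -- $w=\varphi$; its residual is a multiple of $w-\varphi$ of size at most $\kappa\|w-\varphi\|$.
  have hv := fun t : ℝ => (hexp t).smul (((hcos t).smul_const s).sub
    (((hsin t).const_mul Complex.I).smul_const φ))
  have hδ : ∀ t : ℝ, Complex.I • B (Complex.exp (-Complex.I * c * t) •
      ((Real.cos (κ * t) : ℂ) • s - (Complex.I * (Real.sin (κ * t) : ℂ)) • φ)) +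
      (Complex.exp (-Complex.I * c * t) •
        (((-Real.sin (κ * t) * κ : ℝ) : ℂ) • s -
          (Complex.I * ((Real.cos (κ * t) * κ : ℝ) : ℂ)) • φ) +
      (Complex.exp (-Complex.I * c * t) * (-Complex.I * c)) •
        ((Real.cos (κ * t) : ℂ) • s - (Complex.I * (Real.sin (κ * t) : ℂ)) • φ)) =
      (Complex.exp (-Complex.I * c * t) * (Complex.I * κ * Real.cos (κ * t))) • (w - φ) := by
    intro t
    simp only [map_smul, map_sub, hφ, hs]
    push_cast
    match_scalars <;> ring_nf
    all_goals
      simp only [Complex.I_sq]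
      ring
  have h := norm_sub_exp_apply_le hB hv (δ := κ * ‖w - φ‖) (fun t => ?_)
    (show 0 ≤ Real.pi / 2 / κ by positivity)
  · have hκt : κ * (Real.pi / 2 / κ) = Real.pi / 2 := by field_simp
    simp only [Pi.smul_apply', Pi.sub_apply, hκt, Real.cos_pi_div_two,
      Real.sin_pi_div_two, Complex.ofReal_zero, Complex.ofReal_one, zero_smul, zero_sub, mul_one,
      mul_zero, Real.cos_zero, Real.sin_zero, Complex.exp_zero, one_smul, sub_zero,
      ← neg_smul, smul_smul] at h
    refine h.trans_eq ?_
    field_simp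
  · refine (congrArg norm (hδ t)).trans_le ?_
    rw [norm_smul, norm_mul, norm_mul, norm_mul, Complex.norm_I, Complex.norm_real,
      Complex.norm_real, Complex.norm_exp]
    have h1 : |Real.cos (κ * t)| ≤ 1 := Real.abs_cos_le_one _
    have h2 : (-Complex.I * c * t).re = 0 := by simp
    rw [h2, Real.exp_zero, one_mul, one_mul, Real.norm_eq_abs, Real.norm_eq_abs, abs_of_pos hκ]
    gcongr
    exact mul_le_of_le_one_right hκ.le h1

end Duhamel

end LongRangeSearch

/-! ### The search Hamiltonian and its fidelity -/

namespace LongRangeSearch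

open Finset WithLp

/-- Links the matrix exponential in the fidelity to the operator exponential to which Duhamel's
estimate applies. -/
theorem exp_toEuclideanCLM {m : Type*} [Fintype m] [DecidableEq m] (A : Matrix m m ℂ) :
    NormedSpace.exp (Matrix.toEuclideanCLM (n := m) (𝕜 := ℂ) A) =
      Matrix.toEuclideanCLM (n := m) (𝕜 := ℂ) (NormedSpace.exp A) := by
  let +nondep _ : NormedAlgebra ℚ (EuclideanSpace ℂ m →L[ℂ] EuclideanSpace ℂ m) :=
    .restrictScalars ℚ ℂ _
  let : NormedRing (Matrix m m ℂ) := Matrix.linftyOpNormedRing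
  have hcont : Continuous (Matrix.toEuclideanCLM (n := m) (𝕜 := ℂ)).symm :=
    LinearMap.continuous_of_finiteDimensional
      (Matrix.toEuclideanCLM (n := m) (𝕜 := ℂ)).symm.toAlgEquiv.toLinearMap
  have h := NormedSpace.map_exp (Matrix.toEuclideanCLM (n := m) (𝕜 := ℂ)).symm hcont
    (Matrix.toEuclideanCLM (n := m) (𝕜 := ℂ) A)
  rw [StarAlgEquiv.symm_apply_apply] at h
  have h' := congrArg (Matrix.toEuclideanCLM (n := m) (𝕜 := ℂ)) h
  rw [StarAlgEquiv.apply_symm_apply] at h'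
  exact h'

theorem searchHamiltonian_isHermitian (α γ : ℝ) (n : ℕ) (w : Fin n) :
    (searchHamiltonian α γ n w).IsHermitian := by
  refine Matrix.IsHermitian.add ?_ ?_
  · rw [Matrix.IsHermitian, Matrix.conjTranspose_smul, ringHamiltonian_isHermitian α n]
    simp
  · rw [Matrix.IsHermitian, Matrix.conjTranspose_single, star_one]

theorem searchHamiltonian_mulVec (α γ : ℝ) (n : ℕ) (w : Fin n) (x : Fin n → ℂ) :
    searchHamiltonian α γ n w *ᵥ x = (γ : ℂ) • (ringHamiltonian α n *ᵥ x) + Pi.single w (x w) := by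
  rw [searchHamiltonian, Matrix.add_mulVec, Matrix.smul_mulVec, Matrix.single_mulVec]
  congr 1
  ext i
  simp [Pi.single_apply, Function.update_apply]

theorem uniformState_eq (n : ℕ) [NeZero n] :
    uniformState n = fourierMatrix n *ᵥ Pi.single 0 1 := by
  ext j
  simp [uniformState, fourierMatrix_apply_zero]

theorem ringHamiltonian_mulVec_fourierMatrix (α : ℝ) (n : ℕ) [NeZero n] (x : Fin n → ℂ) :
    ringHamiltonian α n *ᵥ (fourierMatrix n *ᵥ x) =
      fourierMatrix n *ᵥ fun k => (dispersion α n k : ℂ) * x k := by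
  rw [Matrix.mulVec_mulVec, ringHamiltonian_mul_fourierMatrix, ← Matrix.mulVec_mulVec]
  congr 1
  ext k
  rw [Matrix.mulVec_diagonal]

theorem searchHamiltonian_mulVec_uniformState (α γ : ℝ) (n : ℕ) [NeZero n] (w : Fin n) :
    searchHamiltonian α γ n w *ᵥ uniformState n =
      ((γ * dispersion α n 0 : ℝ) : ℂ) • uniformState n +
        ((1 / Real.sqrt n : ℝ) : ℂ) • Pi.single w 1 := by
  have h : (fun k => (dispersion α n k : ℂ) * (Pi.single 0 1 : Fin n → ℂ) k) =
      (dispersion α n 0 : ℂ) • (Pi.single 0 1 : Fin n → ℂ) := by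
    ext k
    by_cases hk : k = 0 <;> simp [hk]
  rw [searchHamiltonian_mulVec, uniformState_eq, ringHamiltonian_mulVec_fourierMatrix, h,
    Matrix.mulVec_smul, ← uniformState_eq, smul_smul, ← Complex.ofReal_mul]
  congr 1
  ext i
  simp [uniformState, Pi.single_apply]

theorem single_eq_fourierMatrix_mulVec (n : ℕ) [NeZero n] (w : Fin n) :
    Pi.single w 1 = fourierMatrix n *ᵥ fun k => star (fourierMatrix n w k) := by
  have h : (fun k => star (fourierMatrix n w k)) = (fourierMatrix n)ᴴ *ᵥ Pi.single w 1 := by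
    ext k
    simp
  rw [h, Matrix.mulVec_mulVec, fourierMatrix_mul_conjTranspose, Matrix.one_mulVec]

/-- The normalized image of the marked site under the reduced resolvent of the ring, in which the
search ends up. -/
noncomputable def resolventState (α : ℝ) (n : ℕ) [NeZero n] (w : Fin n) : Fin n → ℂ :=
  fourierMatrix n *ᵥ fun k =>
    (((dispersion α n 0 - dispersion α n k)⁻¹ / resolventMoment α n 1 : ℝ) : ℂ) *
      star (fourierMatrix n w k)

theorem resolventState_self {α : ℝ} (hα : 0 ≤ α) {n : ℕ} [NeZero n] (hn : 2 ≤ n) (w : Fin n) :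
    resolventState α n w w = 1 := by
  have h1 := resolventMoment_pos hα (q := 1) hn
  have h : ∀ k, fourierMatrix n w k *
      ((((dispersion α n 0 - dispersion α n k)⁻¹ / resolventMoment α n 1 : ℝ) : ℂ) *
        star (fourierMatrix n w k)) =
      (((1 / (n : ℝ) * (dispersion α n 0 - dispersion α n k)⁻¹ ^ 1) /
        resolventMoment α n 1 : ℝ) : ℂ) := by
    intro k
    rw [mul_left_comm, fourierMatrix_mul_conj]
    push_cast
    ring
  rw [resolventState, Matrix.mulVec, dotProduct, sum_congr rfl fun k _ => h k,
    ← Complex.ofReal_sum, ← sum_div, ← mul_sum, ← resolventMoment, div_self h1.ne',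
    Complex.ofReal_one]

/-- This fixes the hopping rate: $\gamma(H-E_0)\varphi=-(w-\langle s|w\rangle s)$, and the oracle
adds $\varphi(w)\,w=w$, so $w$ cancels and $s/\sqrt n$ remains. -/
theorem searchHamiltonian_mulVec_resolventState {α : ℝ} (hα : 0 ≤ α) {n : ℕ} [NeZero n]
    (hn : 2 ≤ n) (w : Fin n) :
    searchHamiltonian α (resolventMoment α n 1) n w *ᵥ resolventState α n w =
      ((resolventMoment α n 1 * dispersion α n 0 : ℝ) : ℂ) • resolventState α n w +
        ((1 / Real.sqrt n : ℝ) : ℂ) • uniformState n := by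
  have h1 : (resolventMoment α n 1 : ℂ) ≠ 0 := by
    exact_mod_cast (resolventMoment_pos hα (q := 1) hn).ne'
  have h0 : star (fourierMatrix n w 0) = ((1 / Real.sqrt n : ℝ) : ℂ) := by
    rw [fourierMatrix_apply_zero, Complex.star_def, Complex.conj_ofReal]
  rw [searchHamiltonian_mulVec, resolventState_self hα hn, single_eq_fourierMatrix_mulVec,
    uniformState_eq, resolventState, ringHamiltonian_mulVec_fourierMatrix,
    ← Matrix.mulVec_smul, ← Matrix.mulVec_smul, ← Matrix.mulVec_smul, ← Matrix.mulVec_add,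
    ← Matrix.mulVec_add]
  congr 1
  ext k
  simp only [Pi.add_apply, Pi.smul_apply, smul_eq_mul]
  by_cases hk : k = 0
  · subst hk
    rw [h0]
    simp
  · have hg : ((dispersion α n 0 : ℂ) - dispersion α n k) ≠ 0 := by
      exact_mod_cast (sub_pos.2 (dispersion_lt hα n hk)).ne'
    rw [Pi.single_eq_of_ne hk]
    push_cast
    field_simp
    ring

/-- In Fourier space all components of $w$ have squared modulus $1/n$, so the distance depends only
on the first two resolvent moments and not on $w$. -/
theorem norm_sq_single_sub_resolventState {α : ℝ} (hα : 0 ≤ α) {n : ℕ} [NeZero n] (hn : 2 ≤ n)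
    (w : Fin n) :
    ‖toLp 2 (Pi.single w 1 : Fin n → ℂ) - toLp 2 (resolventState α n w)‖ ^ 2 =
      1 / asymptoticFidelity α n - 1 := by
  have h1 := resolventMoment_pos hα (q := 1) hn
  have h2 := resolventMoment_pos hα (q := 2) hn
  have hU : Matrix.toEuclideanCLM (n := Fin n) (𝕜 := ℂ) (fourierMatrix n) ∈
      unitary (EuclideanSpace ℂ (Fin n) →L[ℂ] EuclideanSpace ℂ (Fin n)) :=
    Unitary.map_mem (Matrix.toEuclideanCLM (n := Fin n) (𝕜 := ℂ))
      (Unitary.mem_iff.2 ⟨conjTranspose_fourierMatrix_mul n, fourierMatrix_mul_conjTranspose n⟩)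
  have hterm : ∀ k, ‖star (fourierMatrix n w k) -
      (((dispersion α n 0 - dispersion α n k)⁻¹ / resolventMoment α n 1 : ℝ) : ℂ) *
        star (fourierMatrix n w k)‖ ^ 2 =
      1 / (n : ℝ) - 2 / resolventMoment α n 1 *
        (1 / (n : ℝ) * (dispersion α n 0 - dispersion α n k)⁻¹ ^ 1) +
      1 / resolventMoment α n 1 ^ 2 *
        (1 / (n : ℝ) * (dispersion α n 0 - dispersion α n k)⁻¹ ^ 2) := by
    intro k
    have hnorm : ‖fourierMatrix n w k‖ ^ 2 = 1 / (n : ℝ) := by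
      have := fourierMatrix_mul_conj n w k
      rw [Complex.star_def, Complex.mul_conj'] at this
      apply Complex.ofReal_injective
      push_cast
      exact this
    rw [← one_sub_mul, norm_mul, norm_star, mul_pow, hnorm, ← Complex.ofReal_one,
      ← Complex.ofReal_sub, Complex.norm_real, Real.norm_eq_abs, sq_abs]
    ring
  rw [single_eq_fourierMatrix_mulVec, resolventState, ← toLp_sub, ← Matrix.mulVec_sub,
    ← Matrix.toEuclideanCLM_toLp, ContinuousLinearMap.norm_map_of_mem_unitary hU,
    EuclideanSpace.norm_sq_eq]
  simp only [Pi.sub_apply, hterm, sum_add_distrib, sum_sub_distrib, ← mul_sum]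
  rw [← resolventMoment, ← resolventMoment, asymptoticFidelity_eq hα hn]
  simp
  field_simp
  ring

theorem searchFidelity_eq (α γ : ℝ) (n : ℕ) (w : Fin n) (T : ℝ) :
    searchFidelity α γ n w T = ‖NormedSpace.exp ((-Complex.I * (T : ℂ)) •
      Matrix.toEuclideanCLM (n := Fin n) (𝕜 := ℂ) (searchHamiltonian α γ n w))
        (toLp 2 (uniformState n)) w‖ ^ 2 := by
  rw [← map_smul, exp_toEuclideanCLM, Matrix.toEuclideanCLM_toLp]
  rfl

theorem abs_searchFidelity_sub_one_le {α : ℝ} (hα : 0 ≤ α) {n : ℕ} [NeZero n] (hn : 2 ≤ n)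
    (w : Fin n) {δ : ℝ} (hδ : δ = Real.pi / 2 * Real.sqrt (1 / asymptoticFidelity α n - 1)) :
    |searchFidelity α (resolventMoment α n 1) n w (Real.pi / 2 * Real.sqrt n) - 1| ≤
      δ * (2 + δ) := by
  have h0 : (0 : ℝ) < n := by exact_mod_cast NeZero.pos n
  have hT : Real.pi / 2 * Real.sqrt n = Real.pi / 2 / (1 / Real.sqrt n) := by simp
  have hB : IsSelfAdjoint (Matrix.toEuclideanCLM (n := Fin n) (𝕜 := ℂ)
      (searchHamiltonian α (resolventMoment α n 1) n w)) :=
    IsSelfAdjoint.map (searchHamiltonian_isHermitian α _ n w) _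
  have h := norm_rotation_sub_exp_apply_le hB (s := toLp 2 (uniformState n))
    (φ := toLp 2 (resolventState α n w)) (w := toLp 2 (Pi.single w 1))
    (c := resolventMoment α n 1 * dispersion α n 0) (κ := 1 / Real.sqrt n) (by positivity)
    (by rw [Matrix.toEuclideanCLM_toLp, searchHamiltonian_mulVec_resolventState hα hn]; rfl)
    (by rw [Matrix.toEuclideanCLM_toLp, searchHamiltonian_mulVec_uniformState]; rfl)
  rw [← hT] at h
  rw [← Real.sqrt_sq (norm_nonneg (toLp 2 (Pi.single w 1 : Fin n → ℂ) - _)),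
    norm_sq_single_sub_resolventState hα hn, ← hδ] at h
  have hw := (PiLp.norm_apply_le _ w).trans h
  rw [PiLp.sub_apply, PiLp.smul_apply] at hw
  have hphase : ‖(Complex.exp (-Complex.I * ((resolventMoment α n 1 * dispersion α n 0 : ℝ) : ℂ) *
      (Real.pi / 2 * Real.sqrt n : ℝ)) * -Complex.I) • (toLp 2 (resolventState α n w)) w‖ = 1 := by
    have hre : (-Complex.I * ((resolventMoment α n 1 * dispersion α n 0 : ℝ) : ℂ) *
        (Real.pi / 2 * Real.sqrt n : ℝ)).re = 0 := by simp
    rw [PiLp.toLp_apply, resolventState_self hα hn, norm_smul, norm_mul, Complex.norm_exp, hre]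
    simp
  have habs := (abs_norm_sub_norm_le _ _).trans hw
  rw [hphase] at habs
  rw [searchFidelity_eq]
  set a := ‖NormedSpace.exp ((-Complex.I * ((Real.pi / 2 * Real.sqrt n : ℝ) : ℂ)) •
      Matrix.toEuclideanCLM (n := Fin n) (𝕜 := ℂ)
        (searchHamiltonian α (resolventMoment α n 1) n w)) (toLp 2 (uniformState n)) w‖
  have ha : 0 ≤ a := norm_nonneg _
  have hδ0 : 0 ≤ δ := (abs_nonneg _).trans habs
  -- The amplitude `a` is within `δ` of $|\varphi(w)|=1$, so $a+1\le 2+\delta$.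
  have hfac : a ^ 2 - 1 = (a - 1) * (a + 1) := by ring
  rw [hfac, abs_mul, abs_sub_comm, abs_of_nonneg (by linarith : 0 ≤ a + 1)]
  have := (abs_le.1 habs).1
  exact mul_le_mul habs (by linarith) (by linarith) hδ0

/-- For each size there is a positive running time at which the search has at least half of its
initial success probability at every marked site. -/
theorem exists_time_half_le_searchFidelity (α γ : ℝ) {n : ℕ} (hn : 0 < n) :
    ∃ T : ℝ, 0 < T ∧ T ≤ 1 ∧ ∀ w : Fin n, 1 / (2 * (n : ℝ)) ≤ searchFidelity α γ n w T := by
  have h0 : (0 : ℝ) < n := by exact_mod_cast hn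
  -- The fidelity is $1/n$ at $T=0$ and continuous; a right neighbourhood keeps $T>0$, and finitely
  -- many sites allow a common $T$.
  have hev : ∀ w : Fin n, ∀ᶠ T in 𝓝[>] (0 : ℝ), 1 / (2 * (n : ℝ)) ≤ searchFidelity α γ n w T := by
    intro w
    have hzero : searchFidelity α γ n w 0 = 1 / (n : ℝ) := by
      have h1 : (-Complex.I * ((0 : ℝ) : ℂ)) • searchHamiltonian α γ n w = 0 := by simp
      rw [searchFidelity, h1, NormedSpace.exp_zero, Matrix.one_mulVec, uniformState, Complex.norm_real, Real.norm_eq_abs,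
        sq_abs, div_pow, Real.sq_sqrt h0.le, one_pow]
    have hcont : Continuous fun T => searchFidelity α γ n w T := by
      simp only [searchFidelity_eq]
      let +nondep _ : NormedAlgebra ℚ
        (EuclideanSpace ℂ (Fin n) →L[ℂ] EuclideanSpace ℂ (Fin n)) := .restrictScalars ℚ ℂ _
      have h1 : Continuous fun T : ℝ => NormedSpace.exp ((-Complex.I * (T : ℂ)) •
          Matrix.toEuclideanCLM (n := Fin n) (𝕜 := ℂ) (searchHamiltonian α γ n w)) :=
        NormedSpace.exp_continuous.comp (by fun_prop)
      have h2 := h1.clm_apply (continuous_const (y := toLp 2 (uniformState n)))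
      exact (((EuclideanSpace.proj w : EuclideanSpace ℂ (Fin n) →L[ℂ] ℂ).continuous.comp
        h2).norm).pow 2
    refine ((hcont.tendsto 0).mono_left nhdsWithin_le_nhds).eventually_const_le ?_
    rw [hzero]
    exact one_div_lt_one_div_of_lt h0 (by linarith)
  obtain ⟨T, hT, hT0, hT1⟩ := ((eventually_all.2 hev).and
    (Ioc_mem_nhdsGT (zero_lt_one' ℝ))).exists
  exact ⟨T, hT0, hT1, hT⟩

end LongRangeSearch

/-! ### Asymptotics and assembly -/

namespace LongRangeSearch

theorem le_asymptoticFidelity {α : ℝ} (hα0 : 0 ≤ α) (hα1 : α < 1) {n : ℕ} (hn : 2 ≤ n) :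
    (1 - α) / 4 ≤ asymptoticFidelity α n := by
  refine le_trans ?_ (spectralGap_mul_le_asymptoticFidelity hα0 hα1 hn)
  have h1 := le_spectralGap hα0 hα1 hn
  have h2 : 1 / (n : ℝ) ≤ 1 / 2 := one_div_le_one_div_of_le two_pos (by exact_mod_cast hn)
  nlinarith

theorem tendsto_search_error {α : ℝ} (hα0 : 0 ≤ α) (hα1 : α < 1) :
    Tendsto (fun n : ℕ => Real.pi / 2 * Real.sqrt (1 / asymptoticFidelity α n - 1) *
      (2 + Real.pi / 2 * Real.sqrt (1 / asymptoticFidelity α n - 1))) atTop (𝓝 0) := by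
  have h1 : Tendsto (fun n : ℕ => 1 / asymptoticFidelity α n - 1) atTop (𝓝 0) := by
    simpa using ((tendsto_asymptoticFidelity hα0 hα1).inv₀ one_ne_zero).sub_const 1
  have h2 := (h1.sqrt).const_mul (Real.pi / 2)
  simpa using h2.mul (h2.const_add 2)

/-- The running time used is $\frac\pi2\sqrt n$; the factor $1/\sqrt{F_\infty}$ is invisible
asymptotically because $F_\infty\to1$. -/
theorem isEquivalent_search_time {α : ℝ} (hα0 : 0 ≤ α) (hα1 : α < 1) :
    (fun n : ℕ => Real.pi / 2 * Real.sqrt n) ~[atTop] fun n : ℕ =>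
      Real.pi / 2 * Real.sqrt ((n : ℝ) / asymptoticFidelity α n) := by
  refine isEquivalent_of_tendsto_one ?_
  have h := (tendsto_asymptoticFidelity hα0 hα1).sqrt
  rw [Real.sqrt_one] at h
  refine h.congr' ?_
  filter_upwards [eventually_ge_atTop 2] with n hn
  have h0 : (0 : ℝ) < n := by exact_mod_cast (by omega : 0 < n)
  have hF : 0 < asymptoticFidelity α n :=
    (by linarith : 0 < (1 - α) / 4).trans_le (le_asymptoticFidelity hα0 hα1 hn)
  have := Real.sqrt_pos.2 h0
  have := Real.sqrt_pos.2 hF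
  rw [Pi.div_apply, Real.sqrt_div h0.le]
  field_simp

end LongRangeSearch

theorem mainTheorem2 (α : ℝ) (hα0 : 0 ≤ α) (hα1 : α < 1) :
    -- the rescaled spectral gap is bounded below by a positive constant
    (∃ c : ℝ, 0 < c ∧ ∀ n : ℕ, 2 ≤ n →
      c ≤ LongRangeSearch.spectralGap α n ∧ LongRangeSearch.spectralGap α n ≤ 1) ∧
    -- the bounds on the asymptotic fidelity
    (∀ n : ℕ, 2 ≤ n →
      LongRangeSearch.spectralGap α n * (1 - 1 / (n : ℝ)) ≤
          LongRangeSearch.asymptoticFidelity α n ∧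
        LongRangeSearch.asymptoticFidelity α n ≤ 1) ∧
    -- the asymptotic fidelity stays bounded away from zero and tends to a positive constant
    (∃ c : ℝ, 0 < c ∧ ∀ n : ℕ, 2 ≤ n → c ≤ LongRangeSearch.asymptoticFidelity α n) ∧
    (∃ L : ℝ, 0 < L ∧
      Tendsto (fun n : ℕ => LongRangeSearch.asymptoticFidelity α n) atTop (𝓝 L)) ∧
    -- optimal search: constant fidelity in time of order `√n`, for every marked site, with a
    -- hopping rate and a running time that do not depend on the marked site
    (∃ (γ T : ℕ → ℝ) (C c : ℝ), 0 < C ∧ 0 < c ∧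
      (∀ n : ℕ, 2 ≤ n → 0 < γ n ∧ 0 < T n ∧ T n ≤ C * Real.sqrt n ∧
        ∀ w : Fin n, c ≤ LongRangeSearch.searchFidelity α (γ n) n w (T n)) ∧
      -- the running time and the fidelity are asymptotically those predicted by `F_∞`
      (T ~[atTop] fun n : ℕ =>
        Real.pi / 2 * Real.sqrt ((n : ℝ) / LongRangeSearch.asymptoticFidelity α n)) ∧
      (∀ ε : ℝ, 0 < ε → ∃ N : ℕ, ∀ n : ℕ, N ≤ n → ∀ w : Fin n,
        |LongRangeSearch.searchFidelity α (γ n) n w (T n) -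
          LongRangeSearch.asymptoticFidelity α n| < ε)) := by
  have hsmall : ∀ n : ℕ, 2 ≤ n → ∃ T : ℝ, 0 < T ∧ T ≤ 1 ∧
      ∀ w : Fin n, 1 / (2 * (n : ℝ)) ≤ LongRangeSearch.searchFidelity α 1 n w T := fun n hn =>
    LongRangeSearch.exists_time_half_le_searchFidelity α 1 (by omega)
  choose! τ hτ0 hτ1 hτ using hsmall
  have herr := LongRangeSearch.tendsto_search_error hα0 hα1
  -- Beyond `N` the error is at most $1/2$, so the fidelity is at least $1/2$. Below it the short
  -- times `τ n` give at least $1/(2n)\ge 1/(2N)$, hence the constant $c=1/(2N)$.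
  obtain ⟨N, hN⟩ := eventually_atTop.1
    ((herr.eventually_le_const (half_pos one_pos)).and (eventually_ge_atTop 2))
  have hN2 : 2 ≤ N := (hN N le_rfl).2
  have hpos : ∀ n, N ≤ n → n ≠ 0 := fun n hn => by omega
  refine ⟨⟨(1 - α) / 2, by linarith, fun n hn =>
      ⟨LongRangeSearch.le_spectralGap hα0 hα1 hn, LongRangeSearch.spectralGap_le_one hα0 hn⟩⟩,
    fun n hn => ⟨LongRangeSearch.spectralGap_mul_le_asymptoticFidelity hα0 hα1 hn,
      LongRangeSearch.asymptoticFidelity_le_one hα0 hn⟩,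
    ⟨(1 - α) / 4, by linarith, fun n hn =>
      LongRangeSearch.le_asymptoticFidelity hα0 hα1 hn⟩,
    ⟨1, one_pos, LongRangeSearch.tendsto_asymptoticFidelity hα0 hα1⟩,
    fun n => if h : N ≤ n then
      haveI : NeZero n := ⟨hpos n h⟩
      LongRangeSearch.resolventMoment α n 1 else 1,
    fun n => if N ≤ n then Real.pi / 2 * Real.sqrt n else τ n,
    Real.pi / 2, 1 / (2 * (N : ℝ)), by positivity, by positivity, fun n hn => ?_, ?_,
    fun ε hε => ?_⟩
  · have h1n : (1 : ℝ) ≤ Real.sqrt n := by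
      rw [Real.one_le_sqrt]
      exact_mod_cast (by omega : 1 ≤ n)
    have hNr : (2 : ℝ) ≤ N := by exact_mod_cast hN2
    by_cases h : N ≤ n
    · have : NeZero n := ⟨hpos n h⟩
      simp only [dif_pos h, if_pos h]
      refine ⟨LongRangeSearch.resolventMoment_pos hα0 hn, by positivity, le_rfl, fun w => ?_⟩
      have h1 := (abs_le.1 ((LongRangeSearch.abs_searchFidelity_sub_one_le hα0 hn w rfl).trans
        (hN n h).1)).1
      have h2 : 1 / (2 * (N : ℝ)) ≤ 1 / 2 :=
        one_div_le_one_div_of_le two_pos (by linarith)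
      linarith
    · simp only [dif_neg h, if_neg h]
      refine ⟨one_pos, hτ0 n hn, ?_, fun w => le_trans ?_ (hτ n hn w)⟩
      · nlinarith [hτ1 n hn, Real.pi_gt_three]
      · have hn0 : (0 : ℝ) < n := by exact_mod_cast (by omega : 0 < n)
        have : (n : ℝ) ≤ N := by exact_mod_cast (not_le.1 h).le
        exact one_div_le_one_div_of_le (by linarith) (by linarith)
  · refine (LongRangeSearch.isEquivalent_search_time hα0 hα1).congr_left ?_
    filter_upwards [eventually_ge_atTop N] with n hn
    rw [if_pos hn]
  -- Both fidelities are compared with $1$, each within $\varepsilon/2$; the bound for the search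
  -- does not involve `w`, which gives uniformity.
  · have hF := ((LongRangeSearch.tendsto_asymptoticFidelity hα0 hα1).const_sub 1).abs
    rw [sub_self, abs_zero] at hF
    obtain ⟨N', hN'⟩ := eventually_atTop.1 ((herr.eventually_lt_const (half_pos hε)).and
      (hF.eventually_lt_const (half_pos hε)))
    refine ⟨max N N', fun n hn w => ?_⟩
    have h := le_of_max_le_left hn
    have : NeZero n := ⟨hpos n h⟩
    obtain ⟨h1, h2⟩ := hN' n (le_of_max_le_right hn)
    simp only [dif_pos h, if_pos h]
    have h3 := LongRangeSearch.abs_searchFidelity_sub_one_le hα0 (hN2.trans h) w rfl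
    refine (abs_sub_le _ 1 _).trans_lt ?_
    linarith
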